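/- Let $\Theta$ be a set of atomic propositions and $N$ a finite set of agents. The formulas of coalition logic with individual and common knowledge are $$\varphi ::= p \mid \neg\varphi \mid \varphi\wedge\varphi \mid [H]\varphi \mid K_i\varphi \mid C_G\varphi \qquad (p\in\Theta,\ i\in N,\ H\subseteq N,\ \emptyset\neq G\subseteq N),$$ with the usual derived connectives ($\varphi\to\psi$ is $\neg(\varphi\wedge\neg\psi)$, $\varphi\leftrightarrow\psi$ is $(\varphi\to\psi)\wedge(\psi\to\varphi)$, $\bot$ is $\chi\wedge\neg\chi$ and $\top$ is $\neg\bot$, for an arbitrary formula $\chi$) and $E_G\varphi$ as a shorthand for $\bigwedge_{i\in G}K_i\varphi$, for $\emptyset\ne G\subseteq N$. The axiom system $CLC$ has as axioms all instances of classical propositional tautologies and all instances of - (G1) $\neg[G]\bot$; (G2) $[G]\top$; (G3) $\neg[\emptyset]\neg\varphi\to[N]\varphi$; (G4) $[G](\varphi\wedge\psi)\to[G]\psi$; (G5) $[G_1]\varphi\wedge[G_2]\psi\to[G_1\cup G_2](\varphi\wedge\psi)$ if $G_1\cap G_2=\emptyset$; - (K) $K_i(\varphi\to\psi)\to(K_i\varphi\to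 K_i\psi)$; (T) $K_i\varphi\to\varphi$; (4) $K_i\varphi\to K_iK_i\varphi$; (5) $\neg K_i\varphi\to K_i\neg K_i\varphi$; - (C1) $E_G\varphi\leftrightarrow\bigwedge_{i\in G}K_i\varphi$; (C2) $C_G\varphi\to E_G(\varphi\wedge C_G\varphi)$, for $G\neq\emptyset$; and as rules: (MP) from $\varphi$ and $\varphi\to\psi$ infer $\psi$; (RG) from $\varphi\leftrightarrow\psi$ infer $[G]\varphi\leftrightarrow[G]\psi$; (RN) from $\varphi$ infer $K_i\varphi$; (RC) from $\varphi\to E_G(\varphi\wedge\psi)$ infer $\varphi\to C_G\psi$, for $G\ne\emptyset$. Write $\vdash_{CLC}\varphi$ if $\varphi$ is derivable in this system. An epistemic coalition model $M=(S,E,(\sim_i)_{i\in N},V)$ consists of a non-empty set $S$ of states, an equivalence relation $\sim_i$ on $S$ for each $i\in N$, a valuation $V(s)\subseteq\Theta$ for each $s\in S$, and for each $s\in S$ a truly playable effectivity function $E(s)\colon 2^N\to 2^{2^S}$, that is, one satisfying, for all $G,G_1,G_2\subseteq N$ and $X,Y\subseteq S$: - (E1) $\emptyset\notin E(s)(G)$;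 - (E2) $S\in E(s)(G)$; - (E3) if $S\setminus X\notin E(s)(\emptyset)$ then $X\in E(s)(N)$; - (E4) if $X\subseteq Y$ and $X\in E(s)(G)$ then $Y\in E(s)(G)$; - (E5) if $G_1\cap G_2=\emptyset$, $X\in E(s)(G_1)$ and $Y\in E(s)(G_2)$, then $X\cap Y\in E(s)(G_1\cup G_2)$; - (E6) $E(s)(\emptyset)$ has an element no proper subset of which belongs to $E(s)(\emptyset)$. Truth at a state is defined by: $M,s\models p$ iff $p\in V(s)$; the usual clauses for $\neg$ and $\wedge$; $M,s\models[G]\varphi$ iff $\{t\in S: M,t\models\varphi\}\in E(s)(G)$; $M,s\models K_i\varphi$ iff $M,t\models\varphi$ for all $t$ with $s\sim_i t$; $M,s\models C_G\varphi$ iff $M,t\models\varphi$ for all $t$ such that $(s,t)$ is in the transitive closure of $\bigcup_{i\in G}\sim_i$. A formula is valid, $\models\varphi$, if $M,s\models\varphi$ for every epistemic coalition model $M$ and every state $s$ of $M$. **Theorem.** For every formula $\varphi$ of coalition logic with individual and common knowledge, $\vdash_{CLC}\varphi$ if and only if $\models\varphi$. -/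

import Mathlib

universe u v w

namespace CLC

/-- Formulas of coalition logic with individual and common knowledge, over the set `Θ` of atomic
propositions and the set `N` of agents: `p`, `¬φ`, `φ ∧ ψ`, `[G]φ` for any coalition `G`,
`K_i φ`, and `C_G φ` for a nonempty coalition `G`. -/
inductive Formula (Θ : Type u) (N : Type v) : Type (max u v)
  | atom (p : Θ) : Formula Θ N
  | neg (φ : Formula Θ N) : Formula Θ N
  | and (φ ψ : Formula Θ N) : Formula Θ N
  | coal (G : Finset N) (φ : Formula Θ N) : Formula Θ N
  | know (i : N) (φ : Formula Θ N) : Formula Θ N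
  | common (G : Finset N) (hG : G.Nonempty) (φ : Formula Θ N) : Formula Θ N

namespace Formula

variable {Θ : Type u} {N : Type v}

/-- `φ → ψ`, as `¬(φ ∧ ¬ψ)`. -/
def imp (φ ψ : Formula Θ N) : Formula Θ N := neg (and φ (neg ψ))

/-- `φ ↔ ψ`. -/
def iff (φ ψ : Formula Θ N) : Formula Θ N := and (imp φ ψ) (imp ψ φ)

/-- The contradiction `⊥`, written with an arbitrary formula `χ`, as `χ ∧ ¬χ`. -/
def bot (χ : Formula Θ N) : Formula Θ N := and χ (neg χ)

/-- The truth constant `⊤`, written with an arbitrary formula `χ`, as `¬(χ ∧ ¬χ)`. -/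
def top (χ : Formula Θ N) : Formula Θ N := neg (bot χ)

/-- The conjunction of the formulas `K_i φ`, for `i` in a list of agents
(`⊤` for the empty list). -/
def conjKnow : List N → Formula Θ N → Formula Θ N
  | [], φ => top φ
  | [i], φ => know i φ
  | i :: j :: l, φ => and (know i φ) (conjKnow (j :: l) φ)

/-- `E_G φ` (everyone in `G` knows `φ`), the shorthand for `⋀_{i ∈ G} K_i φ`. -/
noncomputable def everyone (G : Finset N) (φ : Formula Θ N) : Formula Θ N :=
  conjKnow G.toList φ

/-- `φ` is an instance of a classical propositional tautology: it is true under every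
assignment of truth values to formulas that respects negation and conjunction (formulas of the
other shapes being treated as propositional variables). -/
def IsTautology (φ : Formula Θ N) : Prop :=
  ∀ v : Formula Θ N → Prop,
    (∀ α, v (neg α) ↔ ¬ v α) → (∀ α β, v (and α β) ↔ (v α ∧ v β)) → v φ

end Formula

open Formula in
/-- Derivability in the axiom system CLC. -/
inductive Derivable {Θ : Type u} {N : Type v} [Fintype N] [DecidableEq N] :
    Formula Θ N → Prop
  | prop (φ : Formula Θ N) : IsTautology φ → Derivable φ
  | g1 (G : Finset N) (χ : Formula Θ N) : Derivable (neg (coal G (bot χ)))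
  | g2 (G : Finset N) (χ : Formula Θ N) : Derivable (coal G (top χ))
  | g3 (φ : Formula Θ N) :
      Derivable (imp (neg (coal ∅ (neg φ))) (coal Finset.univ φ))
  | g4 (G : Finset N) (φ ψ : Formula Θ N) : Derivable (imp (coal G (and φ ψ)) (coal G ψ))
  | g5 (G₁ G₂ : Finset N) (φ ψ : Formula Θ N) : G₁ ∩ G₂ = ∅ →
      Derivable (imp (and (coal G₁ φ) (coal G₂ ψ)) (coal (G₁ ∪ G₂) (and φ ψ)))
  | mp (φ ψ : Formula Θ N) : Derivable φ → Derivable (imp φ ψ) → Derivable ψ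
  | rg (G : Finset N) (φ ψ : Formula Θ N) :
      Derivable (iff φ ψ) → Derivable (iff (coal G φ) (coal G ψ))
  | axK (i : N) (φ ψ : Formula Θ N) :
      Derivable (imp (know i (imp φ ψ)) (imp (know i φ) (know i ψ)))
  | axT (i : N) (φ : Formula Θ N) : Derivable (imp (know i φ) φ)
  | ax4 (i : N) (φ : Formula Θ N) : Derivable (imp (know i φ) (know i (know i φ)))
  | ax5 (i : N) (φ : Formula Θ N) :
      Derivable (imp (neg (know i φ)) (know i (neg (know i φ))))
  | c1 (G : Finset N) (hG : G.Nonempty) (φ : Formula Θ N) :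
      Derivable (iff (everyone G φ) (conjKnow G.toList φ))
  | c2 (G : Finset N) (hG : G.Nonempty) (φ : Formula Θ N) :
      Derivable (imp (common G hG φ) (everyone G (and φ (common G hG φ))))
  | rn (i : N) (φ : Formula Θ N) : Derivable φ → Derivable (know i φ)
  | rc (G : Finset N) (hG : G.Nonempty) (φ ψ : Formula Θ N) :
      Derivable (imp φ (everyone G (and φ ψ))) → Derivable (imp φ (common G hG ψ))

/-- An effectivity function over the agents `N` and the states `S`. -/
abbrev Effectivity (N : Type v) (S : Type w) := Finset N → Set (Set S)

/-- The non-monotonic core of the coalition `G`: the inclusion-minimal elements of `E G`. -/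
def nonmonotonicCore {N : Type v} {S : Type w} (E : Effectivity N S) (G : Finset N) :
    Set (Set S) :=
  {X | X ∈ E G ∧ ¬ ∃ Y, Y ∈ E G ∧ Y ⊂ X}

/-- The conditions E1-E6 of true playability. -/
structure TrulyPlayable {N : Type v} [Fintype N] [DecidableEq N] {S : Type w}
    (E : Effectivity N S) : Prop where
  liveness : ∀ G, (∅ : Set S) ∉ E G
  safety : ∀ G, (Set.univ : Set S) ∈ E G
  maximality : ∀ X : Set S, Xᶜ ∉ E ∅ → X ∈ E Finset.univ
  monotone : ∀ (G : Finset N) (X Y : Set S), X ⊆ Y → X ∈ E G → Y ∈ E G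
  superadditive : ∀ (G₁ G₂ : Finset N) (X Y : Set S), G₁ ∩ G₂ = ∅ →
    X ∈ E G₁ → Y ∈ E G₂ → X ∩ Y ∈ E (G₁ ∪ G₂)
  core_nonempty : (nonmonotonicCore E ∅).Nonempty

/-- Epistemic coalition models. -/
structure Model (Θ : Type u) (N : Type v) [Fintype N] [DecidableEq N] where
  State : Type w
  nonempty : Nonempty State
  E : State → Effectivity N State
  trulyPlayable : ∀ s, TrulyPlayable (E s)
  rel : N → State → State → Prop
  equivalence : ∀ i, Equivalence (rel i)
  V : State → Set Θ

/-- Truth of a formula in a state of a model. -/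
def Sat {Θ : Type u} {N : Type v} [Fintype N] [DecidableEq N] (M : Model.{u, v, w} Θ N) :
    Formula Θ N → M.State → Prop
  | .atom p, s => p ∈ M.V s
  | .neg φ, s => ¬ Sat M φ s
  | .and φ ψ, s => Sat M φ s ∧ Sat M ψ s
  | .coal G φ, s => {t | Sat M φ t} ∈ M.E s G
  | .know i φ, s => ∀ t, M.rel i s t → Sat M φ t
  | .common G _ φ, s =>
      ∀ t, Relation.TransGen (fun x y => ∃ i ∈ G, M.rel i x y) s t → Sat M φ t

/-- `φ` is true in every state of every epistemic coalition model
(with states in the universe `w`). -/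
def Valid {Θ : Type u} {N : Type v} [Fintype N] [DecidableEq N] (φ : Formula Θ N) : Prop :=
  ∀ (M : Model.{u, v, w} Θ N) (s : M.State), Sat M φ s

end CLC

/-! Soundness is an induction on derivations. For completeness, Lindenbaum's lemma shows that a
formula lying in all maximal theories is derivable, so it suffices to realise each maximal theory,
as far as `φ` is concerned, at a state of some model. The model is a finite filtration: maximal
theories are identified when they agree on the finite set `closure φ`.

Finiteness makes every set of states definable by a formula (`exists_defines`), and this carries
both hard points. First, `X` can be declared effective for `G` when `[G]ψ` is in the label for some
`ψ` defining `X`; G1-G5 then give E1-E5, and E6 holds because there are finitely many sets. Second,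
the set of states `G`-reachable from `s` is defined by some `δ`; if `φ` holds on that set, then `δ →
E_G(δ ∧ φ)` is derivable and rule RC yields `C_G φ` at `s`. The truth lemma `defines_sat` combines
the two. -/

namespace CLC

open Formula

/-! ### Soundness -/

section Soundness

variable {Θ : Type u} {N : Type v} [Fintype N] [DecidableEq N] (M : Model.{u, v, w} Θ N)

theorem sat_imp (φ ψ : Formula Θ N) (s : M.State) :
    Sat M (imp φ ψ) s ↔ (Sat M φ s → Sat M ψ s) := by
  simp [imp, Sat]

theorem sat_iff (φ ψ : Formula Θ N) (s : M.State) :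
    Sat M (iff φ ψ) s ↔ (Sat M φ s ↔ Sat M ψ s) := by
  simp only [Formula.iff, Sat, sat_imp]
  tauto

theorem sat_conjKnow (l : List N) (φ : Formula Θ N) (s : M.State) :
    Sat M (conjKnow l φ) s ↔ ∀ i ∈ l, Sat M (know i φ) s := by
  induction l with
  | nil => simp [conjKnow, top, bot, Sat]
  | cons i l ih =>
    cases l with
    | nil => simp [conjKnow]
    | cons j l => rw [conjKnow, Sat, ih, List.forall_mem_cons (a := i)]

theorem sat_everyone (G : Finset N) (φ : Formula Θ N) (s : M.State) :
    Sat M (everyone G φ) s ↔ ∀ i ∈ G, ∀ t, M.rel i s t → Sat M φ t := by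
  simp [everyone, sat_conjKnow, Sat]

/-- Every derivable formula is true in every state of every model. -/
theorem Derivable.sat {φ : Formula Θ N} (h : Derivable φ) : ∀ s : M.State, Sat M φ s := by
  induction h with
  | prop φ h =>
    intro s
    exact h (fun ψ => Sat M ψ s) (fun _ => Iff.rfl) (fun _ _ => Iff.rfl)
  | g1 G χ =>
    intro s
    simpa [Sat, bot] using (M.trulyPlayable s).liveness G
  | g2 G χ =>
    intro s
    simpa [Sat, top, bot] using (M.trulyPlayable s).safety G
  | g3 φ =>
    intro s
    rw [sat_imp]
    exact (M.trulyPlayable s).maximality _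
  | g4 G φ ψ =>
    intro s
    rw [sat_imp]
    exact (M.trulyPlayable s).monotone _ _ _ fun _ ht => ht.2
  | g5 G₁ G₂ φ ψ hG =>
    intro s
    rw [sat_imp]
    exact fun h => (M.trulyPlayable s).superadditive _ _ _ _ hG h.1 h.2
  | mp φ ψ _ _ ih₁ ih₂ =>
    intro s
    exact (sat_imp M φ ψ s).1 (ih₂ s) (ih₁ s)
  | rg G φ ψ _ ih =>
    intro s
    have : {t | Sat M φ t} = {t | Sat M ψ t} := Set.ext fun t => (sat_iff M φ ψ t).1 (ih t)
    rw [sat_iff, Sat, Sat, this]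
  | axK i φ ψ =>
    intro s
    simp only [sat_imp, Sat]
    exact fun h₁ h₂ t ht => h₁ t ht (h₂ t ht)
  | axT i φ =>
    intro s
    rw [sat_imp]
    exact fun h => h s ((M.equivalence i).refl s)
  | ax4 i φ =>
    intro s
    rw [sat_imp]
    exact fun h t ht r hr => h r ((M.equivalence i).trans ht hr)
  | ax5 i φ =>
    intro s
    rw [sat_imp]
    exact fun h t ht ht' =>
      h fun r hr => ht' r ((M.equivalence i).trans ((M.equivalence i).symm ht) hr)
  | c1 G hG φ =>
    intro s
    exact (sat_iff M _ _ s).2 Iff.rfl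
  | c2 G hG φ =>
    intro s
    rw [sat_imp, sat_everyone]
    exact fun h i hi t ht => ⟨h t (.single ⟨i, hi, ht⟩), fun r hr => h r (.head ⟨i, hi, ht⟩ hr)⟩
  | rn i φ _ ih => exact fun s t _ => ih t
  | rc G hG φ ψ _ ih =>
    intro s
    rw [sat_imp]
    intro h t ht
    -- The premise of RC makes `φ` an invariant of `G`-steps, with `ψ` true after each step.
    have step {a b : M.State} (ha : Sat M φ a) (hab : ∃ i ∈ G, M.rel i a b) :
        Sat M φ b ∧ Sat M ψ b := by
      obtain ⟨i, hi, hr⟩ := hab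
      exact (sat_everyone M G (and φ ψ) a).1 ((sat_imp M _ _ a).1 (ih a) ha) i hi b hr
    have : Sat M φ t ∧ Sat M ψ t := by
      induction ht with
      | single hab => exact step h hab
      | tail _ hbc ihb => exact step ihb.1 hbc
    exact this.2

end Soundness

/-! ### Maximal theories and Lindenbaum's lemma -/

section MaximalTheories

variable {Θ : Type u} {N : Type v} [Fintype N] [DecidableEq N]

/-- A set of formulas that contains all derivable formulas and is closed under modus ponens. -/
structure IsTheory (Γ : Set (Formula Θ N)) : Prop where
  derivable : ∀ φ, Derivable φ → φ ∈ Γ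
  mp : ∀ φ ψ, φ ∈ Γ → imp φ ψ ∈ Γ → ψ ∈ Γ

/-- A theory that contains exactly one of `φ` and `¬φ`, for every formula `φ`. -/
structure IsMaximal (Γ : Set (Formula Θ N)) : Prop extends IsTheory Γ where
  neg_mem : ∀ φ, neg φ ∈ Γ ↔ φ ∉ Γ

theorem isTheory_derivable : IsTheory {φ : Formula Θ N | Derivable φ} :=
  ⟨fun _ h => h, fun φ ψ => Derivable.mp φ ψ⟩

namespace IsTheory

variable {Γ : Set (Formula Θ N)}

theorem tautology (hΓ : IsTheory Γ) {φ : Formula Θ N} (h : IsTautology φ) : φ ∈ Γ :=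
  hΓ.derivable φ (.prop φ h)

theorem mp_derivable (hΓ : IsTheory Γ) {φ ψ : Formula Θ N} (h : Derivable (imp φ ψ))
    (hφ : φ ∈ Γ) : ψ ∈ Γ :=
  hΓ.mp φ ψ hφ (hΓ.derivable _ h)

/-- This is the theory generated by adding `β` to `Γ`; working with it replaces a deduction theorem.
-/
theorem setOf_imp_mem (hΓ : IsTheory Γ) (β : Formula Θ N) : IsTheory {γ | imp β γ ∈ Γ} where
  derivable φ hφ := hΓ.mp_derivable
    (.prop (imp φ (imp β φ)) fun v hn ha => by simp only [imp, hn, ha]; tauto)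
    (hΓ.derivable φ hφ)
  mp φ ψ h₁ h₂ := hΓ.mp _ _ h₂ <| hΓ.mp_derivable
    (.prop (imp (imp β φ) (imp (imp β (imp φ ψ)) (imp β ψ))) fun v hn ha => by
      simp only [imp, hn, ha]; tauto) h₁

/-- RN and axiom K are exactly the two closure conditions. Maximal extensions of this theory serve
as the `i`-successors of `Γ`. -/
theorem setOf_know_mem (hΓ : IsTheory Γ) (i : N) : IsTheory {γ | know i γ ∈ Γ} where
  derivable φ hφ := hΓ.derivable _ (.rn i φ hφ)
  mp φ ψ h₁ h₂ := hΓ.mp _ _ h₁ (hΓ.mp_derivable (.axK i φ ψ) h₂)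

/-- Lindenbaum's lemma. -/
theorem exists_isMaximal (hΓ : IsTheory Γ) {α : Formula Θ N} (hα : α ∉ Γ) :
    ∃ Δ, IsMaximal Δ ∧ Γ ⊆ Δ ∧ α ∉ Δ := by
  obtain ⟨Δ, hΓΔ, hΔ⟩ := zorn_subset_nonempty {Δ | IsTheory Δ ∧ α ∉ Δ} (by
    intro c hc hchain hne
    refine ⟨⋃₀ c, ⟨⟨?_, ?_⟩, ?_⟩, fun s hs => Set.subset_sUnion_of_mem hs⟩
    · obtain ⟨s, hs⟩ := hne
      exact fun φ hφ => ⟨s, hs, (hc hs).1.derivable φ hφ⟩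
    · rintro φ ψ ⟨s, hs, hφ⟩ ⟨t, ht, hi⟩
      rcases hchain.total hs ht with hst | hts
      · exact ⟨t, ht, (hc ht).1.mp φ ψ (hst hφ) hi⟩
      · exact ⟨s, hs, (hc hs).1.mp φ ψ hφ (hts hi)⟩
    · rintro ⟨s, hs, h⟩
      exact (hc hs).2 h) Γ ⟨hΓ, hα⟩
  have hT : IsTheory Δ := hΔ.prop.1
  -- Otherwise adding `β` to `Δ` would give a strictly larger theory that still omits `α`.
  have key (β : Formula Θ N) (hβ : β ∉ Δ) : imp β α ∈ Δ := by
    by_contra h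
    refine hβ (hΔ.le_of_ge ⟨hT.setOf_imp_mem β, h⟩ (fun γ hγ => ?_) ?_)
    · exact hT.mp_derivable
        (.prop (imp γ (imp β γ)) fun v hn ha => by simp only [imp, hn, ha]; tauto) hγ
    · exact hT.tautology (φ := imp β β) fun v hn ha => by simp only [imp, hn, ha]; tauto
  refine ⟨Δ, ⟨hT, fun φ => ⟨fun hn hφ => ?_, fun hφ => ?_⟩⟩, hΓΔ, hΔ.prop.2⟩
  · exact hΔ.prop.2 <| hT.mp _ _ hn <| hT.mp_derivable
      (.prop (imp φ (imp (neg φ) α)) fun v hn ha => by simp only [imp, hn, ha]; tauto) hφ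
  · by_contra hn
    exact hΔ.prop.2 <| hT.mp _ _ (key _ hn) <| hT.mp_derivable
      (.prop (imp (imp φ α) (imp (imp (neg φ) α) α)) fun v hn ha => by
        simp only [imp, hn, ha]; tauto) (key φ hφ)

end IsTheory

/-- A formula that belongs to every maximal theory is derivable. -/
theorem derivable_of_forall_isMaximal {φ : Formula Θ N}
    (h : ∀ Γ : Set (Formula Θ N), IsMaximal Γ → φ ∈ Γ) : Derivable φ := by
  by_contra hφ
  obtain ⟨Γ, hΓ, -, hn⟩ := isTheory_derivable.exists_isMaximal (α := φ) hφ
  exact hn (h Γ hΓ)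

namespace IsMaximal

variable {Γ : Set (Formula Θ N)}

theorem and_mem (hΓ : IsMaximal Γ) (φ ψ : Formula Θ N) :
    and φ ψ ∈ Γ ↔ φ ∈ Γ ∧ ψ ∈ Γ := by
  refine ⟨fun h => ⟨?_, ?_⟩, fun h => ?_⟩
  · exact hΓ.mp_derivable
      (.prop (imp (and φ ψ) φ) fun v hn ha => by simp only [imp, hn, ha]; tauto) h
  · exact hΓ.mp_derivable
      (.prop (imp (and φ ψ) ψ) fun v hn ha => by simp only [imp, hn, ha]; tauto) h
  · exact hΓ.mp _ _ h.2 <| hΓ.mp_derivable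
      (.prop (imp φ (imp ψ (and φ ψ))) fun v hn ha => by simp only [imp, hn, ha]; tauto) h.1

theorem imp_mem (hΓ : IsMaximal Γ) (φ ψ : Formula Θ N) :
    imp φ ψ ∈ Γ ↔ (φ ∈ Γ → ψ ∈ Γ) := by
  simp [imp, hΓ.neg_mem, hΓ.and_mem]

theorem iff_mem (hΓ : IsMaximal Γ) (φ ψ : Formula Θ N) :
    iff φ ψ ∈ Γ ↔ (φ ∈ Γ ↔ ψ ∈ Γ) := by
  simp only [Formula.iff, hΓ.and_mem, hΓ.imp_mem]
  tauto

theorem bot_notMem (hΓ : IsMaximal Γ) (χ : Formula Θ N) : bot χ ∉ Γ := by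
  simp [bot, hΓ.neg_mem, hΓ.and_mem]

theorem top_mem (hΓ : IsMaximal Γ) (χ : Formula Θ N) : top χ ∈ Γ :=
  (hΓ.neg_mem _).2 (hΓ.bot_notMem χ)

theorem everyone_mem (hΓ : IsMaximal Γ) (G : Finset N) (φ : Formula Θ N) :
    everyone G φ ∈ Γ ↔ ∀ i ∈ G, know i φ ∈ Γ := by
  have (l : List N) : conjKnow l φ ∈ Γ ↔ ∀ i ∈ l, know i φ ∈ Γ := by
    induction l with
    | nil => simp [conjKnow, hΓ.top_mem]
    | cons i l ih =>
      cases l with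
      | nil => simp [conjKnow]
      | cons j l => rw [conjKnow, hΓ.and_mem, ih, List.forall_mem_cons (a := i)]
  simp [everyone, this]

/-- Coalition modalities are not normal, so monotonicity comes from RG applied to `φ ↔ φ ∧ ψ`,
followed by G4. -/
theorem coal_mono (hΓ : IsMaximal Γ) (G : Finset N) {φ ψ : Formula Θ N}
    (h : ∀ Δ : Set (Formula Θ N), IsMaximal Δ → φ ∈ Δ → ψ ∈ Δ) (hφ : coal G φ ∈ Γ) :
    coal G ψ ∈ Γ := by
  have hd : Derivable (iff φ (and φ ψ)) := derivable_of_forall_isMaximal fun Δ hΔ => by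
    rw [hΔ.iff_mem, hΔ.and_mem]
    exact ⟨fun h' => ⟨h', h Δ hΔ h'⟩, fun h' => h'.1⟩
  exact hΓ.mp_derivable (.g4 G φ ψ) <|
    ((hΓ.iff_mem _ _).1 (hΓ.derivable _ (.rg G _ _ hd))).1 hφ

theorem know_mono (hΓ : IsMaximal Γ) (i : N) {φ ψ : Formula Θ N}
    (h : ∀ Δ : Set (Formula Θ N), IsMaximal Δ → φ ∈ Δ → ψ ∈ Δ) (hφ : know i φ ∈ Γ) :
    know i ψ ∈ Γ :=
  (hΓ.setOf_know_mem i).mp_derivable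
    (derivable_of_forall_isMaximal fun Δ hΔ => (hΔ.imp_mem φ ψ).2 (h Δ hΔ)) hφ

/-- If `K_i φ` does not belong to a maximal theory, then some maximal theory with the same
formulas of the form `K_i ψ` does not contain `φ`. -/
theorem exists_notMem_of_know_notMem (hΓ : IsMaximal Γ) {i : N} {φ : Formula Θ N}
    (h : know i φ ∉ Γ) :
    ∃ Δ, IsMaximal Δ ∧ (∀ ψ, know i ψ ∈ Γ ↔ know i ψ ∈ Δ) ∧ φ ∉ Δ := by
  obtain ⟨Δ, hΔ, hsub, hφ⟩ := (hΓ.setOf_know_mem i).exists_isMaximal h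
  -- Axiom 4 transfers `K_i ψ` from `Γ` to `Δ`; axiom 5 transfers `¬K_i ψ`.
  refine ⟨Δ, hΔ, fun ψ => ⟨fun hψ => hsub (hΓ.mp_derivable (.ax4 i ψ) hψ), fun hψ => ?_⟩, hφ⟩
  by_contra hn
  exact (hΔ.neg_mem _).1 (hsub (hΓ.mp_derivable (.ax5 i ψ) ((hΓ.neg_mem _).2 hn))) hψ

theorem mem_of_know_mem (hΓ : IsMaximal Γ) {i : N} {φ : Formula Θ N} (h : know i φ ∈ Γ) :
    φ ∈ Γ :=
  hΓ.mp_derivable (.axT i φ) h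

theorem know_and_common_mem (hΓ : IsMaximal Γ) {G : Finset N} {hG : G.Nonempty}
    {φ : Formula Θ N} (h : common G hG φ ∈ Γ) {i : N} (hi : i ∈ G) :
    know i (and φ (common G hG φ)) ∈ Γ :=
  (hΓ.everyone_mem _ _).1 (hΓ.mp_derivable (.c2 G hG φ) h) i hi

theorem mem_of_common_mem (hΓ : IsMaximal Γ) {G : Finset N} {hG : G.Nonempty}
    {φ : Formula Θ N} (h : common G hG φ ∈ Γ) : φ ∈ Γ := by
  obtain ⟨i, hi⟩ := hG
  exact ((hΓ.and_mem _ _).1 (hΓ.mem_of_know_mem (hΓ.know_and_common_mem h hi))).1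

theorem know_common_mem (hΓ : IsMaximal Γ) {G : Finset N} {hG : G.Nonempty}
    {φ : Formula Θ N} (h : common G hG φ ∈ Γ) {i : N} (hi : i ∈ G) :
    know i (common G hG φ) ∈ Γ :=
  hΓ.know_mono i (fun _ hΔ h' => ((hΔ.and_mem _ _).1 h').2) (hΓ.know_and_common_mem h hi)

end IsMaximal

end MaximalTheories

/-! ### Filtration, definable sets and the truth lemma -/

section Completeness

variable {Θ : Type u} {N : Type v}

/-- The subformulas of a formula, together with `K_i C_G ψ` for every subformula `C_G ψ` and
every agent `i`. -/
def closure : Formula Θ N → Set (Formula Θ N)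
  | .atom p => {.atom p}
  | .neg φ => closure φ
  | .and φ ψ => closure φ ∪ closure ψ
  | .coal G φ => insert (.coal G φ) (closure φ)
  | .know i φ => insert (.know i φ) (closure φ)
  | .common G hG φ => insert (.common G hG φ)
      ((Set.range fun i => .know i (.common G hG φ)) ∪ closure φ)

theorem finite_closure [Finite N] (φ : Formula Θ N) : (closure φ).Finite := by
  induction φ with
  | atom p => exact Set.finite_singleton _
  | neg φ ih => exact ih
  | and φ ψ ih₁ ih₂ => exact ih₁.union ih₂
  | coal G φ ih => exact ih.insert _
  | know i φ ih => exact ih.insert _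
  | common G hG φ ih => exact ((Set.finite_range _).union ih).insert _

variable [Fintype N] [DecidableEq N]

/-- A finite type of states, each labelled by a maximal theory, such that every maximal theory
agrees on the set `Φ` with the label of exactly one state. -/
structure Filtration (Φ : Set (Formula Θ N)) where
  State : Type w
  finite : Finite State
  label : State → Set (Formula Θ N)
  isMaximal : ∀ s, IsMaximal (label s)
  exists_agree : ∀ Γ, IsMaximal Γ → ∃ s, ∀ φ ∈ Φ, φ ∈ label s ↔ φ ∈ Γ
  eq_of_agree : ∀ s t, (∀ φ ∈ Φ, φ ∈ label s ↔ φ ∈ label t) → s = t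

theorem exists_filtration {Φ : Set (Formula Θ N)} (hΦ : Φ.Finite) :
    Nonempty (Filtration.{u, v, w} Φ) := by
  classical
  let r : {Γ : Set (Formula Θ N) // IsMaximal Γ} → Set Φ := fun Γ => {φ | φ.1 ∈ Γ.1}
  have := hΦ.to_subtype
  obtain ⟨n, ⟨e⟩⟩ := Finite.exists_equiv_fin (Set.range r)
  have hr (s : Set.range r) (φ : Formula Θ N) (hφ : φ ∈ Φ) :
      φ ∈ s.2.choose.1 ↔ (⟨φ, hφ⟩ : Φ) ∈ s.1 := by
    conv_rhs => rw [← s.2.choose_spec]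
    rfl
  -- The traces on `Φ` are finitely many, so lifting `Fin n` places the states in any prescribed
  -- universe.
  refine ⟨⟨ULift.{w} (Fin n), inferInstance, fun s => (e.symm s.down).2.choose.1,
    fun s => (e.symm s.down).2.choose.2, fun Γ hΓ => ?_, fun s t h => ?_⟩⟩
  · refine ⟨⟨e ⟨r ⟨Γ, hΓ⟩, Set.mem_range_self _⟩⟩, fun φ hφ => ?_⟩
    rw [hr _ φ hφ, e.symm_apply_apply]
    rfl
  · refine ULift.ext _ _ (e.symm.injective (Subtype.ext (Set.ext fun φ => ?_)))
    rw [← hr _ φ.1 φ.2, ← hr _ φ.1 φ.2]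
    exact h φ.1 φ.2

namespace Filtration

variable {Φ : Set (Formula Θ N)} (F : Filtration.{u, v, w} Φ)

/-- The state whose label agrees on `Φ` with the maximal theory `Γ`. -/
noncomputable def state (Γ : Set (Formula Θ N)) (hΓ : IsMaximal Γ) : F.State :=
  (F.exists_agree Γ hΓ).choose

theorem mem_label_state {Γ : Set (Formula Θ N)} (hΓ : IsMaximal Γ) {φ : Formula Θ N}
    (hφ : φ ∈ Φ) : φ ∈ F.label (F.state Γ hΓ) ↔ φ ∈ Γ :=
  (F.exists_agree Γ hΓ).choose_spec φ hφ

theorem state_label (s : F.State) : F.state (F.label s) (F.isMaximal s) = s :=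
  F.eq_of_agree _ _ fun _ hφ => F.mem_label_state _ hφ

/-- The formula `φ` belongs to exactly those maximal theories whose state is in `X`. -/
def Defines (φ : Formula Θ N) (X : Set F.State) : Prop :=
  ∀ Γ (hΓ : IsMaximal Γ), φ ∈ Γ ↔ F.state Γ hΓ ∈ X

variable {F}

theorem Defines.compl {φ : Formula Θ N} {X : Set F.State} (h : F.Defines φ X) :
    F.Defines (neg φ) Xᶜ := fun Γ hΓ => by
  rw [hΓ.neg_mem, h Γ hΓ, Set.mem_compl_iff]

theorem Defines.inter {φ ψ : Formula Θ N} {X Y : Set F.State} (hX : F.Defines φ X)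
    (hY : F.Defines ψ Y) : F.Defines (and φ ψ) (X ∩ Y) := fun Γ hΓ => by
  rw [hΓ.and_mem, hX Γ hΓ, hY Γ hΓ, Set.mem_inter_iff]

theorem defines_top (χ : Formula Θ N) : F.Defines (top χ) Set.univ := fun Γ hΓ => by
  simp [hΓ.top_mem]

theorem defines_of_mem {φ : Formula Θ N} (hφ : φ ∈ Φ) :
    F.Defines φ {s | φ ∈ F.label s} := fun _ hΓ => (F.mem_label_state hΓ hφ).symm

/-- Finite conjunctions define finite intersections; `χ` is there to write `⊤` for the empty one. -/
theorem exists_defines_iInter (χ : Formula Θ N) {ι : Type*} [Finite ι] (X : ι → Set F.State)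
    (h : ∀ i, ∃ φ, F.Defines φ (X i)) : ∃ φ, F.Defines φ (⋂ i, X i) := by
  classical
  cases nonempty_fintype ι
  have (A : Finset ι) : ∃ φ, F.Defines φ (⋂ i ∈ A, X i) := by
    induction A using Finset.induction_on with
    | empty => exact ⟨top χ, by simpa using defines_top χ⟩
    | insert a A _ ih =>
      obtain ⟨φ, hφ⟩ := ih
      obtain ⟨ψ, hψ⟩ := h a
      exact ⟨and ψ φ, by simpa [Finset.set_biInter_insert] using hψ.inter hφ⟩
  simpa using this Finset.univ

/-- Every set of states is defined by a formula. -/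
theorem exists_defines (χ : Formula Θ N) (X : Set F.State) : ∃ φ, F.Defines φ X := by
  have := F.finite
  have separated (s t : F.State) (hst : s ≠ t) :
      ∃ φ X, F.Defines φ X ∧ s ∉ X ∧ t ∈ X := by
    have : ∃ φ ∈ Φ, ¬ (φ ∈ F.label s ↔ φ ∈ F.label t) := by
      by_contra! h
      exact hst (F.eq_of_agree s t h)
    obtain ⟨φ, hφ, h⟩ := this
    by_cases hs : φ ∈ F.label s
    · exact ⟨_, _, (defines_of_mem hφ).compl, by simpa using hs, by simp; tauto⟩
    · exact ⟨_, _, defines_of_mem hφ, by simpa using hs, by simp; tauto⟩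
  -- Intersecting sets that separate `s` from each other state isolates `{s}`; negating the
  -- resulting formula defines its complement.
  have singleton_compl (s : F.State) : ∃ φ, F.Defines φ {s}ᶜ := by
    choose! f Y hf hs ht using separated s
    obtain ⟨φ, hφ⟩ := exists_defines_iInter χ (fun t : {t // s ≠ t} => (Y t.1)ᶜ)
      fun t => ⟨_, (hf t.1 t.2).compl⟩
    refine ⟨neg φ, ?_⟩
    convert hφ.compl using 2
    ext t
    simp only [Set.mem_singleton_iff, Set.mem_iInter, Set.mem_compl_iff]
    constructor
    · rintro rfl u
      exact hs u.1 u.2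
    · intro h
      by_contra hts
      exact h ⟨t, Ne.symm hts⟩ (ht t (Ne.symm hts))
  -- `X` is the intersection of the complements of the points outside it.
  obtain ⟨φ, hφ⟩ := exists_defines_iInter χ (fun s : {s // s ∉ X} => ({s.1}ᶜ : Set F.State))
    fun s => singleton_compl s.1
  refine ⟨φ, ?_⟩
  convert hφ using 1
  ext t
  simp only [Set.mem_iInter, Set.mem_compl_iff, Set.mem_singleton_iff, Subtype.forall]
  constructor
  · rintro ht s hs rfl
    exact hs ht
  · intro h
    by_contra ht
    exact h t ht rfl

variable (F)

/-- The effectivity function at a state of a filtration. -/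
def effectivity (s : F.State) : Effectivity N F.State := fun G =>
  {X | ∃ φ, F.Defines φ X ∧ coal G φ ∈ F.label s}

variable {F}

/-- The choice of defining formula is immaterial: formulas defining the same set lie in the same
maximal theories, so `coal_mono` exchanges them. -/
theorem Defines.mem_effectivity {φ : Formula Θ N} {X : Set F.State} (h : F.Defines φ X)
    (s : F.State) (G : Finset N) : X ∈ F.effectivity s G ↔ coal G φ ∈ F.label s := by
  refine ⟨?_, fun hφ => ⟨φ, h, hφ⟩⟩
  rintro ⟨ψ, hψ, hm⟩
  exact (F.isMaximal s).coal_mono G (fun Δ hΔ h' => (h Δ hΔ).2 ((hψ Δ hΔ).1 h')) hm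

theorem trulyPlayable_effectivity (χ : Formula Θ N) (s : F.State) :
    TrulyPlayable (F.effectivity s) where
  liveness G := by
    rintro ⟨φ, hφ, h⟩
    refine ((F.isMaximal s).neg_mem _).1 ((F.isMaximal s).derivable _ (.g1 G χ)) ?_
    exact (F.isMaximal s).coal_mono G (fun Δ hΔ h' => ((hφ Δ hΔ).1 h').elim) h
  safety G := ⟨top χ, defines_top χ, (F.isMaximal s).derivable _ (.g2 G χ)⟩
  maximality X hX := by
    obtain ⟨φ, hφ⟩ := exists_defines χ X
    rw [hφ.compl.mem_effectivity, ← (F.isMaximal s).neg_mem] at hX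
    exact ⟨φ, hφ, (F.isMaximal s).mp_derivable (.g3 φ) hX⟩
  monotone G X Y hXY := by
    rintro ⟨φ, hφ, h⟩
    obtain ⟨ψ, hψ⟩ := exists_defines χ Y
    exact ⟨ψ, hψ, (F.isMaximal s).coal_mono G
      (fun Δ hΔ h' => (hψ Δ hΔ).2 (hXY ((hφ Δ hΔ).1 h'))) h⟩
  superadditive G₁ G₂ X Y hG := by
    rintro ⟨φ, hφ, h₁⟩ ⟨ψ, hψ, h₂⟩
    exact ⟨and φ ψ, hφ.inter hψ, (F.isMaximal s).mp_derivable (.g5 G₁ G₂ φ ψ hG)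
      (((F.isMaximal s).and_mem _ _).2 ⟨h₁, h₂⟩)⟩
  core_nonempty := by
    have := F.finite
    -- E6: a nonempty finite family of sets has an inclusion-minimal member.
    obtain ⟨X, hX⟩ := (Set.toFinite (F.effectivity s ∅)).exists_minimal
      ⟨_, top χ, defines_top χ, (F.isMaximal s).derivable _ (.g2 ∅ χ)⟩
    exact ⟨X, hX.prop, fun ⟨Y, hY, hYX⟩ => hX.not_lt hY hYX⟩

variable (F)

/-- The finite model on the states of a filtration. -/
def model (χ : Formula Θ N) (s₀ : F.State) : Model.{u, v, w} Θ N where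
  State := F.State
  nonempty := ⟨s₀⟩
  E := F.effectivity
  trulyPlayable := trulyPlayable_effectivity χ
  rel i s t := ∀ φ, know i φ ∈ Φ → (know i φ ∈ F.label s ↔ know i φ ∈ F.label t)
  equivalence _ :=
    ⟨fun _ _ _ => Iff.rfl, fun h φ hφ => (h φ hφ).symm, fun h h' φ hφ => (h φ hφ).trans (h' φ hφ)⟩
  V s := {p | atom p ∈ F.label s}

variable {F} {χ : Formula Θ N} {s₀ : F.State}

theorem exists_rel_of_know_notMem {Γ : Set (Formula Θ N)} (hΓ : IsMaximal Γ) {i : N}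
    {φ : Formula Θ N} (h : know i φ ∉ Γ) :
    ∃ Δ, ∃ hΔ : IsMaximal Δ, φ ∉ Δ ∧ (F.model χ s₀).rel i (F.state Γ hΓ) (F.state Δ hΔ) := by
  obtain ⟨Δ, hΔ, hsame, hφ⟩ := hΓ.exists_notMem_of_know_notMem h
  exact ⟨Δ, hΔ, hφ, fun ψ hψ =>
    (F.mem_label_state hΓ hψ).trans ((hsame ψ).trans (F.mem_label_state hΔ hψ).symm)⟩

theorem Defines.mem_label {φ : Formula Θ N} {X : Set F.State} (h : F.Defines φ X)
    (s : F.State) : φ ∈ F.label s ↔ s ∈ X := by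
  rw [h _ (F.isMaximal s), state_label]

/-- The truth lemma: the set of states satisfying a formula with closure in `Φ` is defined by
this formula. -/
theorem defines_sat (φ : Formula Θ N) (hφ : closure φ ⊆ Φ) :
    F.Defines φ {s | Sat (F.model χ s₀) φ s} := by
  induction φ with
  | atom p => exact defines_of_mem (hφ rfl)
  | neg φ ih => exact (ih hφ).compl
  | and φ ψ ih₁ ih₂ =>
    exact (ih₁ (Set.subset_union_left.trans hφ)).inter (ih₂ (Set.subset_union_right.trans hφ))
  | coal G φ ih =>
    convert defines_of_mem (hφ (Set.mem_insert _ _)) using 1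
    ext s
    exact (ih ((Set.subset_insert _ _).trans hφ)).mem_effectivity s G
  | know i φ ih =>
    have hmem : know i φ ∈ Φ := hφ (Set.mem_insert _ _)
    have ih := ih ((Set.subset_insert _ _).trans hφ)
    convert defines_of_mem hmem using 1
    ext s
    refine ⟨fun h => ?_, fun h t ht =>
      (ih.mem_label t).1 ((F.isMaximal t).mem_of_know_mem ((ht φ hmem).1 h))⟩
    by_contra hn
    obtain ⟨Δ, hΔ, hΔφ, hr⟩ :=
      exists_rel_of_know_notMem (χ := χ) (s₀ := s₀) (F.isMaximal s) hn
    rw [state_label] at hr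
    exact hΔφ ((ih Δ hΔ).2 (h _ hr))
  | common G hG φ ih =>
    have hmem (i : N) : know i (common G hG φ) ∈ Φ :=
      hφ (Set.mem_insert_of_mem _ (Set.mem_union_left _ (Set.mem_range_self i)))
    have ih := ih ((Set.subset_union_right.trans (Set.subset_insert _ _)).trans hφ)
    convert defines_of_mem (hφ (Set.mem_insert _ _)) using 1
    ext s
    refine ⟨fun h => ?_, fun h t ht => ?_⟩
    · let R : Set F.State :=
        {t | Relation.TransGen (fun x y => ∃ i ∈ G, (F.model χ s₀).rel i x y) s t}
      obtain ⟨δ, hδ⟩ := exists_defines χ R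
      -- If `K_i(δ ∧ φ)` failed in a theory containing `δ`, some `i`-successor would omit `δ ∧ φ`;
      -- but its state is still reachable from `s`, so it contains both conjuncts.
      have hd : Derivable (imp δ (everyone G (and δ φ))) :=
        derivable_of_forall_isMaximal fun Γ hΓ => by
          rw [hΓ.imp_mem, hΓ.everyone_mem]
          intro hδΓ i hi
          by_contra hn
          obtain ⟨Δ, hΔ, hΔφ, hr⟩ := exists_rel_of_know_notMem (χ := χ) (s₀ := s₀) hΓ hn
          have hR : F.state Δ hΔ ∈ R := Relation.TransGen.tail ((hδ Γ hΓ).1 hδΓ) ⟨i, hi, hr⟩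
          exact hΔφ ((hΔ.and_mem _ _).2 ⟨(hδ Δ hΔ).2 hR, (ih Δ hΔ).2 (h _ hR)⟩)
      obtain ⟨i, hi⟩ := id hG
      -- Reachability is a transitive closure only; `s` reaches itself because `G` is nonempty and
      -- the relations are reflexive.
      have hs : s ∈ R := .single ⟨i, hi, ((F.model χ s₀).equivalence i).refl s⟩
      exact (F.isMaximal s).mp_derivable (.rc G hG δ φ hd) ((hδ.mem_label s).2 hs)
    -- The relation only compares formulas `K_i ψ` in `Φ`; this is why the closure contains `K_i C_G
    -- φ`, through which `C_G φ` passes along each step.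
    · have step {a b : F.State} (ha : common G hG φ ∈ F.label a)
          (hab : ∃ i ∈ G, (F.model χ s₀).rel i a b) : common G hG φ ∈ F.label b := by
        obtain ⟨i, hi, hr⟩ := hab
        exact (F.isMaximal b).mem_of_know_mem
          ((hr _ (hmem i)).1 ((F.isMaximal a).know_common_mem ha hi))
      have hC : common G hG φ ∈ F.label t := by
        induction ht with
        | single hab => exact step h hab
        | tail _ hbc ihb => exact step ihb hbc
      exact (ih.mem_label t).1 ((F.isMaximal t).mem_of_common_mem hC)

end Filtration

/-- Every valid formula is derivable. -/
theorem Valid.derivable {φ : Formula Θ N} (h : Valid.{u, v, w} φ) : Derivable φ := by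
  obtain ⟨F⟩ := exists_filtration.{u, v, w} (finite_closure φ)
  exact derivable_of_forall_isMaximal fun Γ hΓ =>
    (Filtration.defines_sat (χ := φ) (s₀ := F.state Γ hΓ) φ subset_rfl Γ hΓ).2 (h _ _)

end Completeness

end CLC

theorem mainTheorem1 {Θ : Type u} {N : Type v} [Fintype N] [DecidableEq N]
    (φ : CLC.Formula Θ N) :
    CLC.Derivable φ ↔ CLC.Valid.{u, v, w} φ :=
  ⟨fun h M s => h.sat M s, CLC.Valid.derivable⟩
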